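/- Let $G$ be a nontrivial finite group. In the achievement game $\mathsf{GEN}(G)$ two players alternately choose previously unselected elements of $G$, and the first player who makes the set of jointly selected elements generate $G$ wins. Thus the starting position is $\emptyset$; the nonterminal positions are the subsets of $G$ that do not generate $G$; the terminal positions are the generating sets $S$ of $G$ such that $\langle S\setminus\{g\}\rangle \neq G$ for some $g\in S$; the options of a nonterminal position $P$ are the sets $P\cup\{g\}$ with $g\in G\setminus P$, and terminal positions have no options. The nim-number of a position is defined recursively as the least nonnegative integer that is not the nim-number of any of its options, the nim-number of a game is that of its starting position, and $\mathsf{GEN}(G)=*n$ means that the nim-number of $\mathsf{GEN}(G)$ is $n$. For a finite abelian group $A$, let $\operatorname{Dih}(A)=C_2\ltimes A$ be the generalized dihedral group, where the nontrivial element of the group $C_2$ of order two acts on $A$ by inversion, and let $d(A)$ be the smallest size of a generating set of $A$. **Theorem.** If $A$ is a nontrivial finite abelian group, then $$ \mathsf{GEN}(\operatorname{Dih}(A))= \begin{cases} *1 & \text{if } d(A)=1 \text{ and } |A|\equiv 2 \pmod 4,\\ *3 & \text{if } 1\le d(A)\le 2 \text{ and } |A| \text{ is odd},\\ *0 & \text{otherwise.}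 \end{cases} $$ -/

import Mathlib

/-- The minimum excludant of a set of natural numbers: the least natural number not in the set
(it exists whenever the set is finite). -/
noncomputable def mex (S : Set ℕ) : ℕ := sInf Sᶜ

/-- An impartial game: a finite set of positions, a set of options for every position, and a
starting position, such that there is no infinite line of play. -/
structure ImpartialGame where
  Position : Type*
  finite : Finite Position
  Opt : Position → Set Position
  start : Position
  wf : WellFounded (fun Q P : Position => Q ∈ Opt P)

namespace ImpartialGame

/-- The nim-number of a position: the minimum excludant of the nim-numbers of its options. -/
noncomputable def nim (Γ : ImpartialGame) : Γ.Position → ℕ :=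
  Γ.wf.fix fun P rec => mex {n | ∃ (Q : Γ.Position) (h : Q ∈ Γ.Opt P), rec Q h = n}

/-- The defining recursion `nim P = mex {nim Q | Q ∈ Opt P}`. -/
theorem nim_eq (Γ : ImpartialGame) (P : Γ.Position) :
    Γ.nim P = mex (Γ.nim '' Γ.Opt P) := by
  rw [nim, WellFounded.fix_eq]
  congr 1
  ext n
  simp only [Set.mem_ofPred_eq, Set.mem_image, exists_prop]

/-- The nim-number of a game is the nim-number of its starting position. -/
noncomputable def nimNumber (Γ : ImpartialGame) : ℕ := Γ.nim Γ.start

end ImpartialGame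

namespace AchievementGame

/-- The positions of the achievement game on `G`: the nonterminal ones are the subsets of `G` that
do not generate `G`; the terminal ones are the generating sets `S` such that removing some
element `g ∈ S` leaves a set that does not generate `G`. -/
def IsPosition {G : Type*} [Group G] (S : Set G) : Prop :=
  Subgroup.closure S ≠ ⊤ ∨
    (Subgroup.closure S = ⊤ ∧ ∃ g ∈ S, Subgroup.closure (S \ {g}) ≠ ⊤)

/-- The options of a nonterminal position `P` are the sets `P ∪ {g}` with `g ∈ G \ P`; a position
that generates `G` has no options. -/
def Opt {G : Type*} [Group G] (P : {S : Set G // IsPosition S}) :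
    Set {S : Set G // IsPosition S} :=
  {Q | Subgroup.closure (P : Set G) ≠ ⊤ ∧ ∃ g ∉ (P : Set G), (Q : Set G) = insert g (P : Set G)}

theorem isPosition_empty (G : Type*) [Group G] [Nontrivial G] : IsPosition (∅ : Set G) := by
  left
  rw [Subgroup.closure_empty]
  exact bot_ne_top

theorem wellFounded_opt (G : Type*) [Group G] [Finite G] :
    WellFounded (fun Q P : {S : Set G // IsPosition S} => Q ∈ Opt P) := by
  refine Subrelation.wf (r := fun Q P : {S : Set G // IsPosition S} => P < Q) ?_
    (wellFounded_gt (α := {S : Set G // IsPosition S}))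
  rintro Q P ⟨-, g, hg, h⟩
  change (P : Set G) < (Q : Set G)
  rw [h]
  exact Set.ssubset_insert hg

end AchievementGame

/-- The achievement game `GEN(G)` on a nontrivial finite group `G`: starting from the empty set,
two players alternately choose a previously unselected element of `G`, and the player who first
makes the set of selected elements generate `G` wins. -/
def GEN (G : Type*) [Group G] [Finite G] [Nontrivial G] : ImpartialGame where
  Position := {S : Set G // AchievementGame.IsPosition S}
  finite := inferInstance
  Opt := AchievementGame.Opt
  start := ⟨∅, AchievementGame.isPosition_empty G⟩
  wf := AchievementGame.wellFounded_opt G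

/-- The action of the group of order two on an abelian group whose nontrivial element acts by
inversion. -/
def inversionAction (A : Type*) [CommGroup A] : Multiplicative (ZMod 2) →* MulAut A where
  toFun k := if k = 1 then 1 else MulEquiv.inv A
  map_one' := if_pos rfl
  map_mul' := by
    have key : ∀ k l : Multiplicative (ZMod 2), k = 1 ∨ l = 1 ∨ (k ≠ 1 ∧ l ≠ 1 ∧ k * l = 1) := by
      decide
    intro k l
    rcases key k l with rfl | rfl | ⟨hk, hl, hkl⟩
    · simp
    · simp
    · ext a
      simp [hk, hl, hkl]

/-- The generalized dihedral group `Dih(A)` of an abelian group `A`: the semidirect product of `A`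
with the group of order two, whose nontrivial element acts on `A` by inversion. -/
abbrev Dih (A : Type*) [CommGroup A] : Type _ :=
  SemidirectProduct A (Multiplicative (ZMod 2)) (inversionAction A)

instance Dih.instFinite (A : Type*) [CommGroup A] [Finite A] : Finite (Dih A) :=
  Finite.of_equiv _ SemidirectProduct.equivProd.symm

instance Dih.instNontrivial (A : Type*) [CommGroup A] : Nontrivial (Dih A) :=
  (SemidirectProduct.equivProd (φ := inversionAction A)).nontrivial

/-! Let H be the subgroup generated by a position and B its subgroup of rotations. The first
reflection leaves B unchanged, and every other move adjoins a single rotation to B, possibly one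
already there (`Dih.opt_cases`). Nim-numbers are therefore governed by a few invariants: whether H
has a reflection, the parity of the number of chosen elements, the parity of |B|, and the corank of
B in A, which a move lowers by at most one and which may be truncated at 3. A move inside H exists
unless H is exhausted, which parity often rules out.

With a reflection, |H| is even and a finite table gives the nim-number (`Dih.nim_of_reflecting`).
Without one, |H| = |B|; if all subgroups above B have orders of the same parity, a table again
suffices (`Dih.nim_of_not_reflecting`). This covers |A| odd and |B| even.

There remains |A| even with |B| odd. In corank 1 it also matters whether B has index 2 and whether 4
divides |A| (`Dih.nim_of_odd_card_base_of_corank_eq_one`). In corank at least 2 an even-sized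
position has only options of nonzero nim-number (`Dih.nim_eq_zero_of_two_le_corank`). At the start B
is trivial, so its corank is d(A) truncated at 3. -/

/-- A natural number missing from a set that contains all smaller ones is its minimum excludant. -/
theorem mex_eq_of_forall_lt {S : Set ℕ} {n : ℕ} (hn : n ∉ S) (h : ∀ m < n, m ∈ S) : mex S = n := by
  refine le_antisymm (Nat.sInf_le hn) ?_
  by_contra! hlt
  exact Nat.sInf_mem (s := Sᶜ) ⟨n, hn⟩ (h _ hlt)

theorem ImpartialGame.nim_eq_of_options (Γ : ImpartialGame) {P : Γ.Position} {n : ℕ}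
    (hne : ∀ Q ∈ Γ.Opt P, Γ.nim Q ≠ n) (hlt : ∀ m < n, ∃ Q ∈ Γ.Opt P, Γ.nim Q = m) :
    Γ.nim P = n := by
  rw [Γ.nim_eq]
  exact mex_eq_of_forall_lt (by rintro ⟨Q, hQ, h⟩; exact hne Q hQ h) hlt

/-- Finiteness of the set of option values matters: `mex` is an `sInf`, which lies in the complement
only if that complement is nonempty. -/
theorem ImpartialGame.nim_ne_of_option (Γ : ImpartialGame) {P Q : Γ.Position} (h : Q ∈ Γ.Opt P) :
    Γ.nim P ≠ Γ.nim Q := by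
  intro he
  have hfin : (Γ.nim '' Γ.Opt P).Finite := by
    have := Γ.finite
    exact Set.toFinite _
  have hmem : mex (Γ.nim '' Γ.Opt P) ∉ Γ.nim '' Γ.Opt P :=
    Nat.sInf_mem (s := (Γ.nim '' Γ.Opt P)ᶜ) hfin.infinite_compl.nonempty
  rw [← Γ.nim_eq, he] at hmem
  exact hmem ⟨Q, h, rfl⟩

/-! ### Moves and generated subgroups -/

namespace AchievementGame

variable {G : Type*} [Group G]

theorem closure_insert_eq_sup (g : G) (S : Set G) :
    Subgroup.closure (insert g S) = Subgroup.closure S ⊔ Subgroup.zpowers g := by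
  rw [← Set.singleton_union, Subgroup.closure_union, ← Subgroup.zpowers_eq_closure, sup_comm]

theorem isPosition_insert {S : Set G} (h : Subgroup.closure S ≠ ⊤) {g : G} (hg : g ∉ S) :
    IsPosition (insert g S) := by
  by_cases ht : Subgroup.closure (insert g S) = ⊤
  · exact Or.inr ⟨ht, g, Set.mem_insert _ _, by rwa [Set.insert_sdiff_self_of_notMem hg]⟩
  · exact Or.inl ht

theorem exists_opt {P : {S : Set G // IsPosition S}} (h : Subgroup.closure (P : Set G) ≠ ⊤)
    {g : G} (hg : g ∉ (P : Set G)) : ∃ Q ∈ Opt P, (Q : Set G) = insert g (P : Set G) :=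
  ⟨⟨_, isPosition_insert h hg⟩, ⟨h, g, hg, rfl⟩, rfl⟩

end AchievementGame

/-! ### Rotations and reflections in subgroups of `Dih A` -/

namespace Dih

open SemidirectProduct

variable {A : Type*} [CommGroup A]

theorem inversionAction_of_ne_one {k : Multiplicative (ZMod 2)} (hk : k ≠ 1) (a : A) :
    inversionAction A k a = a⁻¹ := by
  change (if k = 1 then (1 : MulAut A) else MulEquiv.inv A) a = _
  rw [if_neg hk]; rfl

theorem mul_eq_one_of_ne_one {k l : Multiplicative (ZMod 2)} (hk : k ≠ 1) (hl : l ≠ 1) :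
    k * l = 1 := by
  revert k l; decide

theorem conj_inl_mem (K : Subgroup A) (g : Dih A) {a : A} (ha : a ∈ K) :
    inversionAction A g.right a ∈ K := by
  by_cases hg : g.right = 1
  · simpa [hg] using ha
  · rw [inversionAction_of_ne_one hg]; exact K.inv_mem ha

theorem conj_inl (g : Dih A) (a : A) :
    g * inl a * g⁻¹ = inl (inversionAction A g.right a) := by
  ext <;> simp [mul_comm, mul_left_comm]

instance normal_map_inl (K : Subgroup A) : (K.map (inl : A →* Dih A)).Normal where
  conj_mem := by
    rintro _ ⟨a, ha, rfl⟩ g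
    exact ⟨_, conj_inl_mem K g ha, (conj_inl g a).symm⟩

theorem mul_self_of_right_ne_one {g : Dih A} (hg : g.right ≠ 1) : g * g = 1 := by
  ext
  · simp [inversionAction_of_ne_one hg]
  · simp [mul_eq_one_of_ne_one hg hg]

theorem eq_inl_of_right_eq_one {g : Dih A} (hg : g.right = 1) : g = inl g.left := by
  ext <;> simp [hg]

/-- The subgroup of `A` of the elements whose rotations lie in `H`. -/
def rot (H : Subgroup (Dih A)) : Subgroup A := H.comap inl

/-- A subgroup of `Dih A` that is not contained in `A`. -/
def HasRefl (H : Subgroup (Dih A)) : Prop := ∃ g ∈ H, g.right ≠ 1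

theorem mem_rot {H : Subgroup (Dih A)} {a : A} : a ∈ rot H ↔ (inl a : Dih A) ∈ H := Iff.rfl

theorem HasRefl.mono {H K : Subgroup (Dih A)} (h : HasRefl H) (hHK : H ≤ K) : HasRefl K :=
  let ⟨g, hg, hr⟩ := h
  ⟨g, hHK hg, hr⟩

theorem eq_map_of_not_hasRefl {H : Subgroup (Dih A)} (h : ¬ HasRefl H) :
    H = (rot H).map inl := by
  refine le_antisymm (fun g hg => ?_) (Subgroup.map_comap_le _ _)
  have hr : g.right = 1 := by
    by_contra hr
    exact h ⟨g, hg, hr⟩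
  refine ⟨g.left, ?_, (eq_inl_of_right_eq_one hr).symm⟩
  change (inl g.left : Dih A) ∈ H
  rwa [← eq_inl_of_right_eq_one hr]

theorem eq_top_iff_hasRefl_and_rot {H : Subgroup (Dih A)} :
    H = ⊤ ↔ HasRefl H ∧ rot H = ⊤ := by
  constructor
  · rintro rfl
    exact ⟨⟨inr (Multiplicative.ofAdd 1), trivial, by simp⟩, rfl⟩
  · rintro ⟨⟨h, hh, hr⟩, ht⟩
    have hinl (a : A) : (inl a : Dih A) ∈ H := by rw [← mem_rot, ht]; trivial
    refine (Subgroup.eq_top_iff' H).2 fun g => ?_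
    by_cases hg : g.right = 1
    · rw [eq_inl_of_right_eq_one hg]; exact hinl _
    · have := eq_inl_of_right_eq_one (g := g * h) (by simp [mul_eq_one_of_ne_one hg hr])
      rw [← H.mul_mem_cancel_right hh, this]
      exact hinl _

/-- Subgroups of `A` are normal in `Dih A`, so the join is a product of subgroups and the modular
law applies. -/
theorem rot_sup_zpowers_inl (H : Subgroup (Dih A)) (a : A) :
    rot (H ⊔ Subgroup.zpowers (inl a)) = rot H ⊔ Subgroup.zpowers a := by
  rw [← MonoidHom.map_zpowers]
  apply le_antisymm
  · intro b hb
    obtain ⟨h, hh, _, ⟨c, hc, rfl⟩, hhc⟩ := Subgroup.mem_sup_of_normal_right.1 (mem_rot.1 hb)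
    refine Subgroup.mem_sup.2 ⟨b * c⁻¹, ?_, c, hc, by simp⟩
    rw [mem_rot, map_mul, map_inv, ← hhc]
    simpa using hh
  · refine sup_le (Subgroup.comap_mono le_sup_left) ?_
    rw [rot, ← Subgroup.map_le_iff_le_comap]
    exact le_sup_right

theorem hasRefl_sup_zpowers_inl {H : Subgroup (Dih A)} {a : A} :
    HasRefl (H ⊔ Subgroup.zpowers (inl a)) ↔ HasRefl H := by
  refine ⟨?_, fun h => h.mono le_sup_left⟩
  rw [← MonoidHom.map_zpowers]
  rintro ⟨g, hg, hr⟩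
  obtain ⟨h, hh, _, ⟨c, hc, rfl⟩, rfl⟩ := Subgroup.mem_sup_of_normal_right.1 hg
  exact ⟨h, hh, by simpa using hr⟩

/-- Here `H` lies in `A`, hence is normal, and `g` is an involution; the join is H ∪ Hg, and Hg
consists of reflections. -/
theorem rot_sup_zpowers_of_not_hasRefl {H : Subgroup (Dih A)} (h : ¬ HasRefl H) {g : Dih A}
    (hg : g.right ≠ 1) : rot (H ⊔ Subgroup.zpowers g) = rot H := by
  refine le_antisymm (fun b hb => ?_) (Subgroup.comap_mono le_sup_left)
  have hn : H.Normal := by rw [eq_map_of_not_hasRefl h]; infer_instance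
  obtain ⟨x, hx, _, ⟨k, rfl⟩, hxk⟩ := Subgroup.mem_sup_of_normal_left.1 (mem_rot.1 hb)
  have hx1 : x.right = 1 := by
    by_contra hr
    exact h ⟨x, hx, hr⟩
  have hg2 : g ^ 2 = 1 := by rw [sq, mul_self_of_right_ne_one hg]
  dsimp only at hxk
  rcases Int.even_or_odd' k with ⟨m, rfl | rfl⟩
  · rw [zpow_mul, zpow_ofNat, hg2, one_zpow, mul_one] at hxk
    rwa [mem_rot, ← hxk]
  · rw [zpow_add, zpow_mul, zpow_ofNat, hg2, one_zpow, one_mul, zpow_one] at hxk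
    have := congrArg SemidirectProduct.right hxk
    simp [hx1, hg] at this

/-- Once a reflection `t` is in `H`, a further reflection `g` may be replaced by the rotation `g *
t`. -/
theorem exists_sup_zpowers_eq_of_hasRefl {H : Subgroup (Dih A)} (h : HasRefl H) (g : Dih A) :
    ∃ a : A, H ⊔ Subgroup.zpowers g = H ⊔ Subgroup.zpowers (inl a) := by
  by_cases hr : g.right = 1
  · exact ⟨g.left, by rw [← eq_inl_of_right_eq_one hr]⟩
  · obtain ⟨t, ht, htr⟩ := h
    have he := eq_inl_of_right_eq_one (g := g * t) (by simp [mul_eq_one_of_ne_one hr htr])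
    refine ⟨(g * t).left, ?_⟩
    rw [← he]
    have ht' (K : Subgroup (Dih A)) : t ∈ H ⊔ K := le_sup_left (a := H) ht
    apply le_antisymm <;> refine sup_le le_sup_left (Subgroup.zpowers_le.2 ?_)
    · rw [← Subgroup.mul_mem_cancel_right _ (ht' _)]
      exact le_sup_right (a := H) (Subgroup.mem_zpowers _)
    · exact mul_mem (le_sup_right (a := H) (Subgroup.mem_zpowers _)) (ht' _)

theorem even_card_of_hasRefl [Finite A] {H : Subgroup (Dih A)} (h : HasRefl H) :
    Even (Nat.card H) := by
  obtain ⟨t, ht, hr⟩ := h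
  have ho : orderOf (⟨t, ht⟩ : H) = 2 := by
    refine orderOf_eq_prime ?_ ?_
    · ext1; simpa [sq] using mul_self_of_right_ne_one hr
    · intro h1
      have : t = 1 := congrArg Subtype.val h1
      exact hr (by simp [this])
  refine even_iff_two_dvd.2 (ho.symm.dvd.trans ?_)
  exact orderOf_dvd_natCard _

theorem card_eq_of_not_hasRefl {H : Subgroup (Dih A)} (h : ¬ HasRefl H) :
    Nat.card H = Nat.card (rot H) := by
  conv_lhs => rw [eq_map_of_not_hasRefl h]
  exact Nat.card_congr ((rot H).equivMapOfInjective _ inl_injective).toEquiv.symm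

end Dih

/-! ### Coranks of subgroups of `A` -/

section CyclicQuotients

variable {A : Type*} [CommGroup A]

open Classical in
/-- The smallest number of elements that generate `A` together with `B`, truncated at `3`. -/
noncomputable def corank (B : Subgroup A) : ℕ :=
  if B = ⊤ then 0
  else if ∃ x, B ⊔ Subgroup.zpowers x = ⊤ then 1
  else if ∃ x y, B ⊔ Subgroup.zpowers x ⊔ Subgroup.zpowers y = ⊤ then 2
  else 3

theorem corank_le_three (B : Subgroup A) : corank B ≤ 3 := by
  unfold corank; split_ifs <;> simp

theorem corank_eq_zero {B : Subgroup A} : corank B = 0 ↔ B = ⊤ := by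
  unfold corank; split_ifs <;> simp_all

theorem corank_le_one {B : Subgroup A} :
    corank B ≤ 1 ↔ ∃ x, B ⊔ Subgroup.zpowers x = ⊤ := by
  unfold corank
  split_ifs with h1 h2 h3
  · simp [h1]
  · simpa using h2
  · simpa using h2
  · simpa using h2

theorem corank_le_two {B : Subgroup A} :
    corank B ≤ 2 ↔ ∃ x y, B ⊔ Subgroup.zpowers x ⊔ Subgroup.zpowers y = ⊤ := by
  unfold corank
  split_ifs with h1 h2 h3
  · simp [h1]
  · obtain ⟨x, hx⟩ := h2
    simp only [Nat.one_le_ofNat, true_iff]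
    exact ⟨x, 1, by simp [hx]⟩
  · simpa using h3
  · simpa using h3

theorem corank_sup_zpowers_le (B : Subgroup A) (a : A) :
    corank (B ⊔ Subgroup.zpowers a) ≤ corank B := by
  have h0 : corank B = 0 → corank (B ⊔ Subgroup.zpowers a) = 0 := by
    rw [corank_eq_zero, corank_eq_zero]; rintro rfl; simp
  have h1 : corank B ≤ 1 → corank (B ⊔ Subgroup.zpowers a) ≤ 1 := by
    rw [corank_le_one, corank_le_one]
    rintro ⟨x, hx⟩
    exact ⟨x, by rw [sup_right_comm, hx, top_sup_eq]⟩
  have h2 : corank B ≤ 2 → corank (B ⊔ Subgroup.zpowers a) ≤ 2 := by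
    rw [corank_le_two, corank_le_two]
    rintro ⟨x, y, hx⟩
    exact ⟨x, y, by rw [sup_right_comm B, sup_right_comm, hx, top_sup_eq]⟩
  have := corank_le_three (B ⊔ Subgroup.zpowers a)
  omega

theorem corank_le_corank_sup_zpowers_add_one (B : Subgroup A) (a : A) :
    corank B ≤ corank (B ⊔ Subgroup.zpowers a) + 1 := by
  have h0 : corank (B ⊔ Subgroup.zpowers a) = 0 → corank B ≤ 1 := by
    rw [corank_eq_zero, corank_le_one]; exact fun h => ⟨a, h⟩
  have h1 : corank (B ⊔ Subgroup.zpowers a) ≤ 1 → corank B ≤ 2 := by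
    rw [corank_le_one, corank_le_two]
    exact fun ⟨x, hx⟩ => ⟨a, x, hx⟩
  have := corank_le_three B
  omega

theorem notMem_of_corank_sup_zpowers_ne {B : Subgroup A} {a : A}
    (h : corank (B ⊔ Subgroup.zpowers a) ≠ corank B) : a ∉ B := fun ha => by
  rw [sup_eq_left.2 (Subgroup.zpowers_le.2 ha)] at h
  exact h rfl

theorem exists_corank_sup_zpowers {B : Subgroup A} (h1 : 1 ≤ corank B) (h2 : corank B ≤ 2) :
    ∃ a ∉ B, corank (B ⊔ Subgroup.zpowers a) + 1 = corank B := by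
  suffices ∃ a, corank (B ⊔ Subgroup.zpowers a) + 1 = corank B by
    obtain ⟨a, ha⟩ := this
    exact ⟨a, notMem_of_corank_sup_zpowers_ne (by omega), ha⟩
  by_cases h : corank B ≤ 1
  · obtain ⟨a, ha⟩ := corank_le_one.1 h
    exact ⟨a, by rw [corank_eq_zero.2 ha]; omega⟩
  · obtain ⟨a, b, hab⟩ := corank_le_two.1 h2
    have := corank_le_one.2 ⟨b, hab⟩
    have := corank_le_corank_sup_zpowers_add_one B a
    exact ⟨a, by omega⟩

theorem even_card_of_le [Finite A] {B C : Subgroup A} (hBC : B ≤ C) (h : Even (Nat.card B)) :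
    Even (Nat.card C) :=
  even_iff_two_dvd.2 ((even_iff_two_dvd.1 h).trans (Subgroup.card_dvd_of_le hBC))

theorem corank_ne_zero_of_odd_card {B : Subgroup A} (hA : Even (Nat.card A))
    (hB : Odd (Nat.card B)) : corank B ≠ 0 := by
  rw [Ne, corank_eq_zero]
  rintro rfl
  rw [Subgroup.card_top] at hB
  exact (Nat.not_even_iff_odd.2 hB) hA

theorem rank_le_one_iff_corank_bot [Finite A] : Group.rank A ≤ 1 ↔ corank (⊥ : Subgroup A) ≤ 1 := by
  rw [corank_le_one]
  simp only [bot_sup_eq, Subgroup.zpowers_eq_closure]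
  constructor
  · intro h
    obtain ⟨S, hS, hc⟩ := Group.rank_spec A
    rw [← hS, Finset.card_le_one_iff_subset_singleton] at h
    obtain ⟨x, hx⟩ := h
    refine ⟨x, top_le_iff.1 (hc.ge.trans (Subgroup.closure_mono ?_))⟩
    simpa only [Finset.coe_singleton] using Finset.coe_subset.2 hx
  · rintro ⟨x, hx⟩
    simpa using Group.rank_le (G := A) (S := {x}) (by simpa using hx)

theorem rank_le_two_iff_corank_bot [Finite A] : Group.rank A ≤ 2 ↔ corank (⊥ : Subgroup A) ≤ 2 := by
  classical
  have key (x y : A) : (⊥ : Subgroup A) ⊔ Subgroup.zpowers x ⊔ Subgroup.zpowers y =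
      Subgroup.closure {x, y} := by
    rw [bot_sup_eq, Subgroup.zpowers_eq_closure, Subgroup.zpowers_eq_closure,
      ← Subgroup.closure_union, Set.singleton_union]
  simp only [corank_le_two, key]
  constructor
  · intro h
    obtain ⟨S, hS, hc⟩ := Group.rank_spec A
    rw [← hS] at h
    have hsub : ∃ x y : A, (S : Set A) ⊆ {x, y} := by
      rcases Nat.lt_or_ge S.card 2 with h1 | h2
      · obtain ⟨x, hx⟩ := Finset.card_le_one_iff_subset_singleton.1 (Nat.le_of_lt_succ h1)
        exact ⟨x, x, by simpa only [Finset.coe_singleton, Set.pair_eq_singleton] using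
          Finset.coe_subset.2 hx⟩
      · obtain ⟨x, y, -, rfl⟩ := Finset.card_eq_two.1 (le_antisymm h h2)
        exact ⟨x, y, by simp⟩
    obtain ⟨x, y, hxy⟩ := hsub
    exact ⟨x, y, top_le_iff.1 (hc.ge.trans (Subgroup.closure_mono hxy))⟩
  · rintro ⟨x, y, hx⟩
    exact (Group.rank_le (G := A) (S := {x, y}) (by simpa using hx)).trans Finset.card_le_two

/-- Adjoin an involution: `B` has index at most 2 in the result, so the result is still proper. -/
theorem exists_sup_zpowers_even_card [Finite A] {B : Subgroup A} (hA : Even (Nat.card A))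
    (hB : Odd (Nat.card B)) (hi : 2 < B.index) :
    ∃ a ∉ B, Even (Nat.card (B ⊔ Subgroup.zpowers a : Subgroup A)) ∧
      B ⊔ Subgroup.zpowers a ≠ ⊤ := by
  obtain ⟨z, hz⟩ := exists_prime_orderOf_dvd_card' 2 (even_iff_two_dvd.1 hA)
  have hev : Even (Nat.card (Subgroup.zpowers z)) := by rw [Nat.card_zpowers, hz]; decide
  refine ⟨z, fun h => ?_, even_card_of_le le_sup_right hev, fun h => ?_⟩
  · exact Nat.not_even_iff_odd.2 hB (even_card_of_le (Subgroup.zpowers_le.2 h) hev)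
  · have h2 := Subgroup.relIndex_dvd_card B (Subgroup.zpowers z)
    rw [← Subgroup.relIndex_sup_left, h, Subgroup.relIndex_top_right, Nat.card_zpowers, hz] at h2
    have := Nat.le_of_dvd two_pos h2
    omega

/-- The quotient A/B is cyclic of even order, generated by the class of some `y`; its subgroup of
index 2 is generated by the class of `y ^ 2`. -/
theorem exists_sup_zpowers_index_two [Finite A] {B : Subgroup A} (hA : Even (Nat.card A))
    (hB : Odd (Nat.card B)) (hi : 2 < B.index) (hc : corank B ≤ 1) :
    ∃ a ∉ B, (B ⊔ Subgroup.zpowers a).index = 2 := by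
  obtain ⟨y, hy⟩ := corank_le_one.1 hc
  have hrep (c : A) : ∃ b ∈ B, ∃ k : ℤ, b * y ^ k = c := by
    obtain ⟨b, hb, _, ⟨k, rfl⟩, h⟩ := Subgroup.mem_sup.1 (hy ▸ Subgroup.mem_top c)
    exact ⟨b, hb, k, h⟩
  have hindex (C : Subgroup A) (hBC : B ≤ C) (hyC : y ^ 2 ∈ C) (hy1 : y ∉ C) : C.index = 2 := by
    rw [Subgroup.index_eq_two_iff]
    have hodd (m : ℤ) : y ^ (2 * m) ∈ C := by
      rw [zpow_mul, zpow_ofNat]; exact C.zpow_mem hyC m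
    refine ⟨y, fun c => ?_⟩
    obtain ⟨b, hb, k, rfl⟩ := hrep c
    rw [mul_assoc, ← zpow_add_one, C.mul_mem_cancel_left (hBC hb), C.mul_mem_cancel_left (hBC hb)]
    rcases Int.even_or_odd' k with ⟨m, rfl | rfl⟩
    · refine Or.inr ⟨hodd m, ?_⟩
      rwa [zpow_add, zpow_one, C.mul_mem_cancel_left (hodd m)]
    · refine Or.inl ⟨?_, ?_⟩
      · have := hodd (m + 1)
        rwa [show 2 * m + 1 + 1 = 2 * (m + 1) by ring]
      · rwa [zpow_add, zpow_one, C.mul_mem_cancel_left (hodd m)]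
  -- Otherwise `B` contains all `k`-th powers, among them every involution, since an involution is
  -- its own odd power; but |B| is odd.
  have hyodd (k : ℕ) (hk : Odd k) : y ^ k ∉ B := by
    intro hyk
    have htop : ∀ c : A, c ^ k ∈ B := fun c => by
      obtain ⟨b, hb, j, rfl⟩ := hrep c
      rw [mul_pow, ← zpow_natCast (y ^ j), zpow_comm, zpow_natCast]
      exact mul_mem (pow_mem hb _) (zpow_mem hyk _)
    obtain ⟨z, hz⟩ := exists_prime_orderOf_dvd_card' 2 (even_iff_two_dvd.1 hA)
    obtain ⟨m, rfl⟩ := hk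
    have hzB := htop z
    rw [pow_succ, pow_mul, ← hz, pow_orderOf_eq_one, one_pow, one_mul] at hzB
    refine Nat.not_even_iff_odd.2 hB (even_card_of_le (Subgroup.zpowers_le.2 hzB) ?_)
    rw [Nat.card_zpowers, hz]; decide
  have hynot : y ∉ B ⊔ Subgroup.zpowers (y ^ 2) := by
    intro h
    obtain ⟨b, hb, _, ⟨k, rfl⟩, h⟩ := Subgroup.mem_sup.1 h
    dsimp only at h
    have hmem : y ^ (1 - 2 * k) ∈ B := by
      rwa [zpow_sub, zpow_one, zpow_mul, zpow_ofNat, ← eq_mul_inv_of_mul_eq h]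
    have hodd : Odd (1 - 2 * k).natAbs := by
      rw [Int.natAbs_odd]; exact ⟨-k, by ring⟩
    refine hyodd _ hodd ?_
    rcases Int.natAbs_eq (1 - 2 * k) with h' | h'
    · rw [h', zpow_natCast] at hmem; exact hmem
    · rw [h', zpow_neg, zpow_natCast, inv_mem_iff] at hmem; exact hmem
  refine ⟨y ^ 2, fun h => ?_, hindex _ le_sup_left
    (le_sup_right (a := B) (Subgroup.mem_zpowers _)) hynot⟩
  have := hindex B le_rfl h (by simpa using hyodd 1 odd_one)
  omega

/-- For an involution `z`, the single element `a * z` generates both `a` and `z` because `a` has odd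
order. With `B` it generates a subgroup whose order is divisible by 2 and by the odd number |A|/2.
-/
theorem corank_le_one_of_index_two [Finite A] {B : Subgroup A} {a : A}
    (hodd : Odd (Nat.card (B ⊔ Subgroup.zpowers a : Subgroup A)))
    (hi : (B ⊔ Subgroup.zpowers a).index = 2) : corank B ≤ 1 := by
  have hcard := Subgroup.card_mul_index (B ⊔ Subgroup.zpowers a)
  rw [hi] at hcard
  obtain ⟨z, hz⟩ := exists_prime_orderOf_dvd_card' 2 (Dvd.intro_left _ hcard)
  have haodd : Odd (orderOf a) := by
    refine hodd.of_dvd_nat ?_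
    rw [← Nat.card_zpowers]
    exact Subgroup.card_dvd_of_le le_sup_right
  have hzmem : z ∈ B ⊔ Subgroup.zpowers (a * z) := by
    have hpow : (a * z) ^ orderOf a = z := by
      obtain ⟨m, hm⟩ := haodd
      rw [mul_pow, pow_orderOf_eq_one, one_mul, hm, pow_succ, pow_mul, ← hz, pow_orderOf_eq_one,
        one_pow, one_mul]
    have hmem := Subgroup.npow_mem_zpowers (a * z) (orderOf a)
    rw [hpow] at hmem
    exact le_sup_right (a := B) hmem
  have hamem : a ∈ B ⊔ Subgroup.zpowers (a * z) := by
    rw [← Subgroup.mul_mem_cancel_right _ hzmem]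
    exact le_sup_right (a := B) (Subgroup.mem_zpowers _)
  have h1 : Nat.card (B ⊔ Subgroup.zpowers a : Subgroup A) ∣
      Nat.card (B ⊔ Subgroup.zpowers (a * z) : Subgroup A) :=
    Subgroup.card_dvd_of_le (sup_le le_sup_left (Subgroup.zpowers_le.2 hamem))
  have h2 : 2 ∣ Nat.card (B ⊔ Subgroup.zpowers (a * z) : Subgroup A) := by
    rw [← hz, ← Nat.card_zpowers]
    exact Subgroup.card_dvd_of_le (Subgroup.zpowers_le.2 hzmem)
  refine corank_le_one.2 ⟨a * z, Subgroup.eq_top_of_le_card _ ?_⟩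
  rw [← hcard]
  exact Nat.le_of_dvd Nat.card_pos
    (Nat.Coprime.mul_dvd_of_dvd_of_dvd (Nat.coprime_two_right.2 hodd) h1 h2)

end CyclicQuotients

/-! ### Positions and options in terms of `base` and `Reflecting` -/

namespace Dih

open AchievementGame SemidirectProduct

variable {A : Type*} [CommGroup A]

/-- The rotations in the subgroup generated by a position. -/
def base (P : {S : Set (Dih A) // IsPosition S}) : Subgroup A :=
  rot (Subgroup.closure (P : Set (Dih A)))

/-- A position that contains a reflection. -/
def Reflecting (P : {S : Set (Dih A) // IsPosition S}) : Prop :=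
  HasRefl (Subgroup.closure (P : Set (Dih A)))

theorem closure_ne_top_of_not_reflecting {P : {S : Set (Dih A) // IsPosition S}}
    (h : ¬ Reflecting P) : Subgroup.closure (P : Set (Dih A)) ≠ ⊤ :=
  fun ht => h (eq_top_iff_hasRefl_and_rot.1 ht).1

theorem closure_ne_top_of_corank_ne_zero {P : {S : Set (Dih A) // IsPosition S}}
    (h : corank (base P) ≠ 0) : Subgroup.closure (P : Set (Dih A)) ≠ ⊤ :=
  fun ht => h (corank_eq_zero.2 (eq_top_iff_hasRefl_and_rot.1 ht).2)

theorem corank_ne_zero_of_reflecting {P : {S : Set (Dih A) // IsPosition S}}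
    (h : Reflecting P) (ht : Subgroup.closure (P : Set (Dih A)) ≠ ⊤) : corank (base P) ≠ 0 :=
  fun h0 => ht (eq_top_iff_hasRefl_and_rot.2 ⟨h, corank_eq_zero.1 h0⟩)

variable [Finite A]

theorem opt_cases {P Q : {S : Set (Dih A) // IsPosition S}} (hQ : Q ∈ Opt P) :
    (Q : Set (Dih A)).ncard = (P : Set (Dih A)).ncard + 1 ∧
      (((Reflecting Q ↔ Reflecting P) ∧ ∃ a, base Q = base P ⊔ Subgroup.zpowers a) ∨
        (¬ Reflecting P ∧ Reflecting Q ∧ base Q = base P)) := by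
  obtain ⟨-, g, hg, hQ⟩ := hQ
  refine ⟨by rw [hQ, Set.ncard_insert_of_notMem hg (Set.toFinite _)], ?_⟩
  unfold base Reflecting
  rw [hQ, closure_insert_eq_sup]
  by_cases hP : HasRefl (Subgroup.closure (P : Set (Dih A)))
  · obtain ⟨a, ha⟩ := exists_sup_zpowers_eq_of_hasRefl hP g
    rw [ha, rot_sup_zpowers_inl, hasRefl_sup_zpowers_inl]
    exact Or.inl ⟨Iff.rfl, a, rfl⟩
  · by_cases hr : g.right = 1
    · rw [eq_inl_of_right_eq_one hr, rot_sup_zpowers_inl, hasRefl_sup_zpowers_inl]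
      exact Or.inl ⟨Iff.rfl, _, rfl⟩
    · exact Or.inr ⟨hP, ⟨g, le_sup_right (a := Subgroup.closure (P : Set (Dih A)))
        (Subgroup.mem_zpowers g), hr⟩, rot_sup_zpowers_of_not_hasRefl hP hr⟩

theorem exists_opt_rotation {P : {S : Set (Dih A) // IsPosition S}}
    (h : Subgroup.closure (P : Set (Dih A)) ≠ ⊤) {a : A} (ha : a ∉ base P) :
    ∃ Q ∈ Opt P, (Q : Set (Dih A)).ncard = (P : Set (Dih A)).ncard + 1 ∧
      (Reflecting Q ↔ Reflecting P) ∧ base Q = base P ⊔ Subgroup.zpowers a := by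
  have hg : (inl a : Dih A) ∉ (P : Set (Dih A)) := fun hg => ha (Subgroup.subset_closure hg)
  obtain ⟨Q, hQ, hQe⟩ := exists_opt h hg
  refine ⟨Q, hQ, (opt_cases hQ).1, ?_⟩
  unfold base Reflecting
  rw [hQe, closure_insert_eq_sup, rot_sup_zpowers_inl, hasRefl_sup_zpowers_inl]
  exact ⟨Iff.rfl, rfl⟩

theorem exists_opt_reflection {P : {S : Set (Dih A) // IsPosition S}} (h : ¬ Reflecting P) :
    ∃ Q ∈ Opt P, (Q : Set (Dih A)).ncard = (P : Set (Dih A)).ncard + 1 ∧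
      Reflecting Q ∧ base Q = base P := by
  have hr : (inr (Multiplicative.ofAdd 1) : Dih A).right ≠ 1 := by simp
  obtain ⟨Q, hQ, hQe⟩ := exists_opt (closure_ne_top_of_not_reflecting h)
    fun hg => h ⟨_, Subgroup.subset_closure hg, hr⟩
  refine ⟨Q, hQ, (opt_cases hQ).1, ?_⟩
  unfold base Reflecting
  rw [hQe, closure_insert_eq_sup]
  exact ⟨⟨_, le_sup_right (a := Subgroup.closure (P : Set (Dih A))) (Subgroup.mem_zpowers _), hr⟩,
    rot_sup_zpowers_of_not_hasRefl h hr⟩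

theorem exists_opt_same_closure {P : {S : Set (Dih A) // IsPosition S}}
    (h : Subgroup.closure (P : Set (Dih A)) ≠ ⊤)
    (hcard : (P : Set (Dih A)).ncard ≠ Nat.card (Subgroup.closure (P : Set (Dih A)))) :
    ∃ Q ∈ Opt P, (Q : Set (Dih A)).ncard = (P : Set (Dih A)).ncard + 1 ∧
      (Reflecting Q ↔ Reflecting P) ∧ base Q = base P := by
  obtain ⟨g, hgH, hg⟩ : ∃ g ∈ Subgroup.closure (P : Set (Dih A)), g ∉ (P : Set (Dih A)) := by
    by_contra! hsub
    refine hcard ?_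
    rw [← SetLike.coe_sort_coe, Nat.card_coe_set_eq]
    congr 1
    exact Set.Subset.antisymm Subgroup.subset_closure hsub
  obtain ⟨Q, hQ, hQe⟩ := exists_opt h hg
  refine ⟨Q, hQ, (opt_cases hQ).1, ?_⟩
  unfold base Reflecting
  rw [hQe, closure_insert_eq_sup, sup_eq_left.2 (Subgroup.zpowers_le.2 hgH)]
  exact ⟨Iff.rfl, rfl⟩

/-- A set of odd size cannot exhaust a subgroup of even order. -/
theorem exists_opt_same_of_reflecting {P : {S : Set (Dih A) // IsPosition S}}
    (h : Reflecting P) (ht : Subgroup.closure (P : Set (Dih A)) ≠ ⊤)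
    (hp : (P : Set (Dih A)).ncard % 2 = 1) :
    ∃ Q ∈ Opt P, (Q : Set (Dih A)).ncard = (P : Set (Dih A)).ncard + 1 ∧
      Reflecting Q ∧ base Q = base P := by
  have := even_card_of_hasRefl h
  obtain ⟨Q, hQ, hc, hr, hb⟩ := exists_opt_same_closure ht fun he => by
    rw [← he, Nat.even_iff] at this; omega
  exact ⟨Q, hQ, hc, hr.2 h, hb⟩

theorem exists_opt_same_of_not_reflecting {P : {S : Set (Dih A) // IsPosition S}}
    (h : ¬ Reflecting P) (hp : (P : Set (Dih A)).ncard % 2 ≠ Nat.card (base P) % 2) :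
    ∃ Q ∈ Opt P, (Q : Set (Dih A)).ncard = (P : Set (Dih A)).ncard + 1 ∧
      ¬ Reflecting Q ∧ base Q = base P := by
  have := card_eq_of_not_hasRefl h
  obtain ⟨Q, hQ, hc, hr, hb⟩ := exists_opt_same_closure (closure_ne_top_of_not_reflecting h)
    fun he => by rw [he, this] at hp; exact hp rfl
  exact ⟨Q, hQ, hc, hr.not.2 h, hb⟩

/-! ### Nim-numbers of positions -/

/-- The nim-number of a position with a reflection, in terms of the corank of its rotations and the
parity of its size. -/
def reflTable : ℕ → ℕ → ℕ
  | 0, _ => 0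
  | 1, 0 => 1
  | 1, _ => 2
  | 2, 0 => 0
  | 2, _ => 2
  | _, 0 => 0
  | _, _ => 1

theorem nim_of_reflecting (P : (GEN (Dih A)).Position) (h : Reflecting P) :
    (GEN (Dih A)).nim P = reflTable (corank (base P)) (P.1.ncard % 2) := by
  -- No option repeats the value; `q = 0` is excluded because such positions are terminal.
  have hT : ∀ q ≤ 3, q ≠ 0 → ∀ q' ≤ q, q ≤ q' + 1 → ∀ p < 2,
      reflTable q' (1 - p) ≠ reflTable q p := by decide
  -- Smaller values are reached by staying in the same subgroup, guaranteed at odd size, or by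
  -- lowering the corank.
  have hT' : ∀ q ≤ 3, ∀ p < 2, ∀ m < reflTable q p,
      (p = 1 ∧ m = reflTable q 0) ∨ (1 ≤ q ∧ q ≤ 2 ∧ m = reflTable (q - 1) (1 - p)) := by decide
  induction P using (GEN (Dih A)).wf.induction with
  | _ P ih =>
  have hq := corank_le_three (base P)
  have hp : P.1.ncard % 2 < 2 := Nat.mod_lt _ two_pos
  have hp' : (P.1.ncard + 1) % 2 = 1 - P.1.ncard % 2 := by omega
  refine (GEN (Dih A)).nim_eq_of_options (fun Q hQ => ?_) (fun m hm => ?_)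
  · have h0 := corank_ne_zero_of_reflecting h hQ.1
    obtain ⟨hc, ⟨hr, a, ha⟩ | ⟨hn, -⟩⟩ := opt_cases hQ
    · rw [ih Q hQ (hr.2 h), hc, hp', ha]
      exact hT _ hq h0 _ (corank_sup_zpowers_le _ _) (corank_le_corank_sup_zpowers_add_one _ _) _ hp
    · exact absurd h hn
  · have h0 : corank (base P) ≠ 0 := fun h0 => by rw [h0] at hm; exact absurd hm (Nat.not_lt_zero _)
    have ht := closure_ne_top_of_corank_ne_zero h0
    rcases hT' _ hq _ hp m hm with ⟨h1, rfl⟩ | ⟨h1, h2, rfl⟩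
    · obtain ⟨Q, hQ, hc, hr, hb⟩ := exists_opt_same_of_reflecting h ht h1
      exact ⟨Q, hQ, by rw [ih Q hQ hr, hc, hp', hb, h1]⟩
    · obtain ⟨a, ha, hq'⟩ := exists_corank_sup_zpowers h1 h2
      obtain ⟨Q, hQ, hc, hr, hb⟩ := exists_opt_rotation ht ha
      exact ⟨Q, hQ, by rw [ih Q hQ (hr.2 h), hc, hp', hb, ← hq', Nat.add_sub_cancel]⟩

/-- The induction common to `oddTable` and `evenTable`. The parity `s` is that of every subgroup
above the base, so a move that keeps the subgroup is certain when the size has parity other than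
`s`. -/
theorem nim_of_not_reflecting (T : ℕ → ℕ → ℕ) (s : ℕ)
    (hT : ∀ q ≤ 3, ∀ q' ≤ q, q ≤ q' + 1 → ∀ p < 2, T q' (1 - p) ≠ T q p)
    (hR : ∀ q ≤ 3, ∀ p < 2, reflTable q (1 - p) ≠ T q p)
    (hT' : ∀ q ≤ 3, ∀ p < 2, ∀ m < T q p, (p ≠ s ∧ m = T q (1 - p)) ∨ m = reflTable q (1 - p) ∨
      (1 ≤ q ∧ q ≤ 2 ∧ m = T (q - 1) (1 - p)))
    (P : (GEN (Dih A)).Position) (h : ¬ Reflecting P)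
    (hs : ∀ C, base P ≤ C → Nat.card C % 2 = s) :
    (GEN (Dih A)).nim P = T (corank (base P)) (P.1.ncard % 2) := by
  induction P using (GEN (Dih A)).wf.induction with
  | _ P ih =>
  have hq := corank_le_three (base P)
  have hp : P.1.ncard % 2 < 2 := Nat.mod_lt _ two_pos
  have hp' : (P.1.ncard + 1) % 2 = 1 - P.1.ncard % 2 := by omega
  refine (GEN (Dih A)).nim_eq_of_options (fun Q hQ => ?_) (fun m hm => ?_)
  · obtain ⟨hc, ⟨hr, a, ha⟩ | ⟨-, hr, hb⟩⟩ := opt_cases hQ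
    · rw [ih Q hQ (hr.not.2 h) fun C hC => hs C ((ha ▸ le_sup_left).trans hC), hc, hp', ha]
      exact hT _ hq _ (corank_sup_zpowers_le _ _) (corank_le_corank_sup_zpowers_add_one _ _) _ hp
    · rw [nim_of_reflecting Q hr, hc, hp', hb]
      exact hR _ hq _ hp
  · rcases hT' _ hq _ hp m hm with ⟨h1, rfl⟩ | rfl | ⟨h1, h2, rfl⟩
    · obtain ⟨Q, hQ, hc, hr, hb⟩ := exists_opt_same_of_not_reflecting h
        (h1.trans_eq (hs _ le_rfl).symm)
      exact ⟨Q, hQ, by rw [ih Q hQ hr (hb ▸ hs), hc, hp', hb]⟩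
    · obtain ⟨Q, hQ, hc, hr, hb⟩ := exists_opt_reflection h
      exact ⟨Q, hQ, by rw [nim_of_reflecting Q hr, hc, hp', hb]⟩
    · obtain ⟨a, ha, hq'⟩ := exists_corank_sup_zpowers h1 h2
      obtain ⟨Q, hQ, hc, hr, hb⟩ := exists_opt_rotation (closure_ne_top_of_not_reflecting h) ha
      exact ⟨Q, hQ, by rw [ih Q hQ (hr.not.2 h) fun C hC => hs C ((hb ▸ le_sup_left).trans hC),
        hc, hp', hb, ← hq', Nat.add_sub_cancel]⟩

/-- The nim-number of a position without reflections in `Dih A` for `A` of odd order. -/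
def oddTable : ℕ → ℕ → ℕ
  | 0, 0 => 2
  | 0, _ => 1
  | 1, 0 => 3
  | 1, _ => 0
  | 2, 0 => 3
  | 2, _ => 1
  | _, 0 => 0
  | _, _ => 1

/-- The nim-number of a position without reflections that generates a group of even order. -/
def evenTable : ℕ → ℕ → ℕ
  | 0, 0 => 1
  | 0, _ => 2
  | 1, 0 => 0
  | 1, _ => 2
  | _, 0 => 0
  | _, _ => 1

set_option synthInstance.maxSize 1024 in
set_option synthInstance.maxHeartbeats 200000 in
theorem nim_of_odd_card (hA : Odd (Nat.card A)) (P : (GEN (Dih A)).Position)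
    (h : ¬ Reflecting P) :
    (GEN (Dih A)).nim P = oddTable (corank (base P)) (P.1.ncard % 2) :=
  nim_of_not_reflecting oddTable 1 (by decide) (by decide) (by decide) P h fun C _ =>
    Nat.odd_iff.1 (hA.of_dvd_nat C.card_subgroup_dvd_card)

set_option synthInstance.maxSize 1024 in
set_option synthInstance.maxHeartbeats 200000 in
theorem nim_of_even_card_base (P : (GEN (Dih A)).Position) (h : ¬ Reflecting P)
    (hP : Even (Nat.card (base P))) :
    (GEN (Dih A)).nim P = evenTable (corank (base P)) (P.1.ncard % 2) :=
  nim_of_not_reflecting evenTable 0 (by decide) (by decide) (by decide) P h fun C hC =>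
    Nat.even_iff.1 (even_card_of_le hC hP)

/-- The decisive positions are the odd-sized ones whose base has index 2, of nim-number 0. Since the
base has odd order they occur only if 4 does not divide |A|, and then every even-sized position can
move to one. -/
theorem nim_of_odd_card_base_of_corank_eq_one (hA : Even (Nat.card A))
    (P : (GEN (Dih A)).Position) (h : ¬ Reflecting P) (hP : Odd (Nat.card (base P)))
    (hq : corank (base P) = 1) :
    (GEN (Dih A)).nim P =
      if P.1.ncard % 2 = 0 then (if 4 ∣ Nat.card A then 0 else 1)
      else (if (base P).index = 2 then 0 else 2) := by
  induction P using (GEN (Dih A)).wf.induction with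
  | _ P ih =>
  have hp : P.1.ncard % 2 = 0 ∨ P.1.ncard % 2 = 1 := Nat.mod_two_eq_zero_or_one _
  have hp' : (P.1.ncard + 1) % 2 = 1 - P.1.ncard % 2 := by omega
  have four {B : Subgroup A} (hB : Odd (Nat.card B)) (hi : B.index = 2) : ¬ 4 ∣ Nat.card A := by
    rw [← B.card_mul_index, hi]
    obtain ⟨k, hk⟩ := hB
    omega
  refine (GEN (Dih A)).nim_eq_of_options (fun Q hQ => ?_) (fun m hm => ?_)
  · obtain ⟨hc, ⟨hr, a, ha⟩ | ⟨-, hr, hb⟩⟩ := opt_cases hQ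
    · have hle : corank (base Q) ≤ 1 := by rw [ha, ← hq]; exact corank_sup_zpowers_le _ _
      rcases Nat.even_or_odd (Nat.card (base Q)) with hev | hod
      · rw [nim_of_even_card_base Q (hr.not.2 h) hev, hc, hp']
        -- No subgroup lies strictly between, so an even-order base is all of `A`; this rules out
        -- the value `evenTable 1 0 = 0`.
        have h2 : (base P).index = 2 → corank (base Q) = 0 := fun hi => by
          rw [corank_eq_zero, ← Subgroup.index_eq_one]
          have hdvd := Subgroup.index_dvd_of_le (ha ▸ le_sup_left : base P ≤ base Q)
          rw [hi] at hdvd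
          refine ((Nat.dvd_prime Nat.prime_two).1 hdvd).resolve_right fun hi' => ?_
          have h1 := (base P).card_mul_index
          rw [← (base Q).card_mul_index, hi, hi'] at h1
          rw [Nat.eq_of_mul_eq_mul_right two_pos h1] at hP
          exact Nat.not_even_iff_odd.2 hP hev
        rcases hp with hp | hp <;> rcases Nat.le_one_iff_eq_zero_or_eq_one.1 hle with h01 | h01 <;>
          simp only [hp, h01, one_ne_zero, ↓reduceIte, Nat.sub_zero, Nat.sub_self] <;> split_ifs with hif <;>
          first | decide | exact absurd (h01.symm.trans (h2 hif)) one_ne_zero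
      · have h1 : corank (base Q) = 1 := by
          have := corank_ne_zero_of_odd_card hA hod
          omega
        rw [ih Q hQ (hr.not.2 h) hod h1, hc, hp']
        rcases hp with hp | hp <;> simp only [hp, one_ne_zero, ↓reduceIte, Nat.sub_zero, Nat.sub_self] <;>
          split_ifs <;>
          first | decide | exact absurd ‹_› (four hod ‹_›) | exact absurd ‹_› (four hP ‹_›)
    · rw [nim_of_reflecting Q hr, hc, hp', hb, hq]
      rcases hp with hp | hp <;> simp only [hp, one_ne_zero, ↓reduceIte, Nat.sub_zero, Nat.sub_self] <;>
        split_ifs <;> decide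
  · have hi (h2 : (base P).index ≠ 2) : 2 < (base P).index := by
      have h0 := (base P).index_ne_zero_of_finite
      have h1 : (base P).index ≠ 1 := fun h1 => by
        rw [Subgroup.index_eq_one, ← corank_eq_zero] at h1
        omega
      omega
    have ht := closure_ne_top_of_not_reflecting h
    rcases hp with hp | hp
    · rw [if_pos hp] at hm
      split_ifs at hm with h4
      · exact absurd hm (Nat.not_lt_zero _)
      obtain rfl : m = 0 := by omega
      by_cases h2 : (base P).index = 2
      · obtain ⟨Q, hQ, hc, hr, hb⟩ := exists_opt_same_of_not_reflecting h (by
          rw [hp, Nat.odd_iff.1 hP]; exact zero_ne_one)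
        exact ⟨Q, hQ, by rw [ih Q hQ hr (hb ▸ hP) (hb ▸ hq), hc, hp', hb, h2, hp]; rfl⟩
      · obtain ⟨a, ha, hai⟩ := exists_sup_zpowers_index_two hA hP (hi h2) hq.le
        obtain ⟨Q, hQ, hc, hr, hb⟩ := exists_opt_rotation ht ha
        rw [← hb] at hai
        have hod : Odd (Nat.card (base Q)) := by
          by_contra hev
          rw [Nat.not_odd_iff_even, even_iff_two_dvd] at hev
          refine h4 ?_
          rw [← (base Q).card_mul_index, hai]
          exact mul_dvd_mul_right hev 2
        have h1 : corank (base Q) = 1 := by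
          have h1 := corank_ne_zero_of_odd_card hA hod
          have h2 := corank_sup_zpowers_le (base P) a
          rw [← hb] at h2
          omega
        exact ⟨Q, hQ, by rw [ih Q hQ (hr.not.2 h) hod h1, hc, hp', hai, hp]; rfl⟩
    · rw [if_neg (by omega)] at hm
      split_ifs at hm with h2
      · exact absurd hm (Nat.not_lt_zero _)
      interval_cases m
      -- Value 0 comes from `evenTable 1 0`, reached by a proper base of even order; value 1 comes
      -- from `reflTable 1 0`.
      · obtain ⟨a, ha, hev, hat⟩ := exists_sup_zpowers_even_card hA hP (hi h2)
        obtain ⟨Q, hQ, hc, hr, hb⟩ := exists_opt_rotation ht ha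
        have h1 : corank (base P ⊔ Subgroup.zpowers a) = 1 := by
          have h1 := mt corank_eq_zero.1 hat
          have h2 := corank_sup_zpowers_le (base P) a
          omega
        exact ⟨Q, hQ, by
          rw [nim_of_even_card_base Q (hr.not.2 h) (hb ▸ hev), hc, hp', hb, h1, hp]; rfl⟩
      · obtain ⟨Q, hQ, hc, hr, hb⟩ := exists_opt_reflection h
        exact ⟨Q, hQ, by rw [nim_of_reflecting Q hr, hc, hp', hb, hq, hp]; rfl⟩

theorem nim_eq_zero_of_two_le_corank (hA : Even (Nat.card A))
    (P : (GEN (Dih A)).Position) (h : ¬ Reflecting P)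
    (hq : 2 ≤ corank (base P)) (hp : P.1.ncard % 2 = 0) : (GEN (Dih A)).nim P = 0 := by
  refine (GEN (Dih A)).nim_eq_of_options (fun Q hQ => ?_) fun m hm => absurd hm (Nat.not_lt_zero _)
  have hq3 := corank_le_three (base P)
  obtain ⟨hc, ⟨hr, a, ha⟩ | ⟨-, hr, hb⟩⟩ := opt_cases hQ
  · have hle : 1 ≤ corank (base Q) := by
      have := corank_le_corank_sup_zpowers_add_one (base P) a
      rw [← ha] at this
      omega
    have hq3' := corank_le_three (base Q)
    rcases Nat.even_or_odd (Nat.card (base Q)) with hev | hod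
    · rw [nim_of_even_card_base Q (hr.not.2 h) hev, hc, Nat.succ_mod_two_eq_one_iff.2 hp]
      interval_cases corank (base Q) <;> decide
    · by_cases h1 : corank (base Q) = 1
      · rw [nim_of_odd_card_base_of_corank_eq_one hA Q (hr.not.2 h) hod h1, if_neg (by omega),
          if_neg]
        · decide
        · rw [ha] at hod ⊢
          intro hi
          have := corank_le_one_of_index_two hod hi
          omega
      -- The exact value of `Q` is not needed: replying with a reflection reaches nim-number 0, so
      -- `Q` is nonzero.
      · obtain ⟨R, hR, hc', hr', hb'⟩ := exists_opt_reflection (hr.not.2 h)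
        have h0 : (GEN (Dih A)).nim R = 0 := by
          rw [nim_of_reflecting R hr', hc', hb', hc, show (P.1.ncard + 1 + 1) % 2 = 0 by omega]
          interval_cases corank (base Q) <;> first | rfl | exact absurd rfl h1
        rw [← h0]
        exact (GEN (Dih A)).nim_ne_of_option hR
  · rw [nim_of_reflecting Q hr, hc, Nat.succ_mod_two_eq_one_iff.2 hp, hb]
    interval_cases corank (base P) <;> decide

end Dih

/-! ### The starting position -/

theorem mainTheorem1 {A : Type*} [CommGroup A] [Finite A] [Nontrivial A] :
    (GEN (Dih A)).nimNumber =
      if Group.rank A = 1 ∧ Nat.card A ≡ 2 [MOD 4] then 1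
      else if (1 ≤ Group.rank A ∧ Group.rank A ≤ 2) ∧ Odd (Nat.card A) then 3
      else 0 := by
  set P : (GEN (Dih A)).Position := (GEN (Dih A)).start
  have hPe : P.1 = ∅ := rfl
  have hclosure : Subgroup.closure P.1 = ⊥ := by rw [hPe, Subgroup.closure_empty]
  have hr : ¬ Dih.Reflecting P := by
    rintro ⟨g, hg, hgr⟩
    rw [hclosure, Subgroup.mem_bot] at hg
    exact hgr (by rw [hg]; rfl)
  have hb : Dih.base P = ⊥ := by
    change Subgroup.comap _ (Subgroup.closure P.1) = _
    rw [hclosure, MonoidHom.comap_bot, MonoidHom.ker_eq_bot_iff]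
    exact SemidirectProduct.inl_injective
  have hodd : Odd (Nat.card (Dih.base P)) := by rw [hb, Subgroup.card_bot]; exact odd_one
  have hcard : P.1.ncard % 2 = 0 := by rw [hPe, Set.ncard_empty]
  have h1 := rank_le_one_iff_corank_bot (A := A)
  have h2 := rank_le_two_iff_corank_bot (A := A)
  have h3 := corank_le_three (⊥ : Subgroup A)
  have hq0 : corank (⊥ : Subgroup A) ≠ 0 := by rw [Ne, corank_eq_zero]; exact bot_ne_top
  have hr0 : 1 ≤ Group.rank A := Group.rank_pos (G := A)
  change (GEN (Dih A)).nim P = _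
  rcases Nat.even_or_odd (Nat.card A) with hA | hA
  · have hA' := Nat.not_odd_iff_even.2 hA
    rw [if_neg (c := (1 ≤ Group.rank A ∧ Group.rank A ≤ 2) ∧ Odd (Nat.card A)) fun h => hA' h.2]
    by_cases hq : corank (⊥ : Subgroup A) = 1
    · rw [Dih.nim_of_odd_card_base_of_corank_eq_one hA P hr hodd (hb ▸ hq), if_pos hcard]
      have hrank : Group.rank A = 1 := le_antisymm (h1.2 hq.le) hr0
      have h4 : Nat.card A ≡ 2 [MOD 4] ↔ ¬ 4 ∣ Nat.card A := by
        rw [Nat.even_iff] at hA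
        unfold Nat.ModEq
        omega
      by_cases h : 4 ∣ Nat.card A <;> simp [h4, h, hrank]
    · rw [Dih.nim_eq_zero_of_two_le_corank hA P hr (by rw [hb]; omega) hcard, if_neg]
      rintro ⟨h, -⟩
      omega
  · rw [Dih.nim_of_odd_card hA P hr, hcard, hb, if_neg]
    · by_cases hq : corank (⊥ : Subgroup A) ≤ 2
      · rw [if_pos ⟨⟨hr0, h2.2 hq⟩, hA⟩]
        interval_cases corank (⊥ : Subgroup A) <;> first | rfl | exact absurd rfl hq0
      · rw [if_neg (fun h => hq (h2.1 h.1.2)), show corank (⊥ : Subgroup A) = 3 by omega]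
        rfl
    · rintro ⟨-, h⟩
      rw [Nat.odd_iff] at hA
      unfold Nat.ModEq at h
      omega
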